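/- Let $\mathcal G=(\mathcal V,\mathcal E,\boldsymbol W)$ be a strongly connected weighted digraph on $\mathcal V=\{1,\dots,n\}$ with nonnegative weighted adjacency matrix $\boldsymbol W$ (for $n=1$ the vertex carries a loop, so that the walk below is defined). Let $d_i=\sum_j \boldsymbol W_{i,j}$ be the (out-)degree of $i$, $d_{\mathcal G}=\sum_i d_i$ the volume, $\boldsymbol P_{i,j}=\boldsymbol W_{i,j}/d_i$ the transition matrix of the random walk on $\mathcal G$, $\boldsymbol\pi$ its stationary distribution ($\boldsymbol\pi^\top\boldsymbol P=\boldsymbol\pi^\top$, $\boldsymbol\pi^\top\mathbf 1=1$), and $\boldsymbol\Pi=\mathrm{Diag}(\boldsymbol\pi)$. Let $H(i,j)$ be the expected time at which the walk started at $i$ first visits $j$ (so $H(i,i)=0$), and let $P_{\mathrm{es}}(i,j)$ be the probability that the walk started at $i$ reaches $j$ before it returns to $i$. Put $\Omega(i,i)=0$ and $\Omega(i,j)=\dfrac{1}{d_{\mathcal G}\boldsymbol\pi_i P_{\mathrm{es}}(i,j)}$ for $i\ne j$, and define $$R(\mathcal G)=\sum_{i<j}\Omega(i,j),\qquad R^*(\mathcal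 G)=d_{\mathcal G}^2\sum_{i<j}\boldsymbol\pi_i\boldsymbol\pi_j\,\Omega(i,j),\qquad K(\mathcal G)=\sum_{j}\boldsymbol\pi_jH(i,j),$$ $$\boldsymbol L=d_{\mathcal G}\boldsymbol\Pi(\boldsymbol I-\boldsymbol P),\qquad \widetilde{\boldsymbol L}=\frac{\boldsymbol\Pi^{-1/2}}{\sqrt{d_{\mathcal G}}}\,\boldsymbol L\,\frac{\boldsymbol\Pi^{-1/2}}{\sqrt{d_{\mathcal G}}}.$$ Write $\boldsymbol A^\dagger$ for the Moore–Penrose inverse of a matrix and $\lambda_1(\boldsymbol A),\dots,\lambda_n(\boldsymbol A)$ for its complex eigenvalues with algebraic multiplicity. Then: 1. $R(\mathcal G)=n\,\mathrm{Tr}(\boldsymbol L^\dagger)=n\displaystyle\sum_{\lambda_i(\boldsymbol L)\neq0}\frac1{\lambda_i(\boldsymbol L)}$. 2. $K(\mathcal G)$ is finite and, for every choice of the starting vertex $i$ in its definition, $$R^*(\mathcal G)=d_{\mathcal G}K(\mathcal G)=d_{\mathcal G}\sum_{\lambda_i(\widetilde{\boldsymbol L})\neq0}\frac1{\lambda_i(\widetilde{\boldsymbol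 L})}=d_{\mathcal G}\,\mathrm{Tr}(\widetilde{\boldsymbol L}^\dagger).$$ -/

import Mathlib

open MeasureTheory ProbabilityTheory
open scoped ENNReal

/-- A strongly connected weighted digraph on the vertex set `{0, …, n - 1}`, given by its weighted
adjacency matrix: there is an arc from `i` to `j` exactly when `0 < weight i j`.
Reachability is by directed walks with at least one arc. For `2 ≤ n` this is the same as
reachability of every vertex from every other vertex; for `n = 1` it asks for a loop, without which
the single vertex has degree zero and no random walk exists. -/
structure StronglyConnectedDigraph (n : ℕ) where
  weight : Matrix (Fin n) (Fin n) ℝ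
  weight_nonneg : ∀ i j, 0 ≤ weight i j
  connected : ∀ i j, Relation.TransGen (fun a b => 0 < weight a b) i j

/-- `X` is the Moore–Penrose inverse of the real square matrix `A`. -/
structure IsMoorePenroseInverse {n : ℕ} (A X : Matrix (Fin n) (Fin n) ℝ) : Prop where
  mul_mul_self : A * X * A = A
  inv_mul_mul : X * A * X = X
  symm_left : (A * X).transpose = A * X
  symm_right : (X * A).transpose = X * A

/-- The Moore–Penrose inverse `A†`: the (unique) matrix with the four Penrose properties. -/
noncomputable def pseudoinverse {n : ℕ} (A : Matrix (Fin n) (Fin n) ℝ) :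
    Matrix (Fin n) (Fin n) ℝ :=
  Classical.epsilon (IsMoorePenroseInverse A)

/-- `∑_{λ_i(A) ≠ 0} 1 / λ_i(A)`, over the `n` complex eigenvalues of the real matrix `A`, counted
with algebraic multiplicity (that is, over the roots of the characteristic polynomial). -/
noncomputable def sumInvNonzeroEigenvalues {n : ℕ} (A : Matrix (Fin n) (Fin n) ℝ) : ℂ :=
  (((A.map Complex.ofReal).charpoly.roots.filter (fun z => z ≠ 0)).map (fun z => 1 / z)).sum

namespace StronglyConnectedDigraph

variable {n : ℕ} (G : StronglyConnectedDigraph n)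

/-- The (out-)degree of a vertex. -/
noncomputable def degree (i : Fin n) : ℝ := ∑ j, G.weight i j

/-- The volume `d_G`. -/
noncomputable def volume : ℝ := ∑ i, G.degree i

/-- The transition matrix `P = D⁻¹ W`. -/
noncomputable def transition : Matrix (Fin n) (Fin n) ℝ :=
  Matrix.of fun i j => G.weight i j / G.degree i

theorem degree_pos (i : Fin n) : 0 < G.degree i := by
  obtain ⟨k, hk, -⟩ := Relation.TransGen.head'_iff.mp (G.connected i i)
  exact lt_of_lt_of_le hk
    (Finset.single_le_sum (fun j _ => G.weight_nonneg i j) (Finset.mem_univ k))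

theorem sum_ofReal_transition (i : Fin n) :
    ∑ j, ENNReal.ofReal (G.transition i j) = 1 := by
  rw [← ENNReal.ofReal_sum_of_nonneg]
  · have h : ∑ j, G.transition i j = 1 := by
      simp only [transition, Matrix.of_apply, ← Finset.sum_div]
      exact div_self (G.degree_pos i).ne'
    rw [h, ENNReal.ofReal_one]
  · intro j _
    exact div_nonneg (G.weight_nonneg i j) (G.degree_pos i).le

/-- The law of the next vertex of a walker at `i`: vertex `j` has probability `P i j`. -/
noncomputable def stepLaw (i : Fin n) : PMF (Fin n) :=
  PMF.ofFintype (fun j => ENNReal.ofReal (G.transition i j)) (G.sum_ofReal_transition i)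

/-- The one-step kernel of the walk, as a kernel on histories up to time `t`: the next vertex
depends on the history through the vertex at time `t` only. -/
noncomputable def historyKernel (t : ℕ) : Kernel ((_ : Finset.Iic t) → Fin n) (Fin n) :=
  Kernel.ofFunOfCountable fun x => (G.stepLaw (x ⟨t, Finset.mem_Iic.mpr le_rfl⟩)).toMeasure

instance isMarkovKernel_historyKernel (t : ℕ) : IsMarkovKernel (G.historyKernel t) where
  isProbabilityMeasure x :=
    PMF.toMeasure.isProbabilityMeasure (G.stepLaw (x ⟨t, Finset.mem_Iic.mpr le_rfl⟩))

/-- The law, on the space `ℕ → Fin n` of trajectories, of the random walk started at `i`. -/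
noncomputable def walkLaw (i : Fin n) : Measure (ℕ → Fin n) :=
  Kernel.traj (X := fun _ => Fin n) G.historyKernel 0 (fun _ => i)

/-- `p` is a stationary distribution: `pᵀ P = pᵀ` and the entries of `p` sum to one. -/
def IsStationary (p : Fin n → ℝ) : Prop :=
  Matrix.vecMul p G.transition = p ∧ ∑ i, p i = 1

/-- The (unique) stationary distribution `π`. -/
noncomputable def stationary : Fin n → ℝ := Classical.epsilon G.IsStationary

/-- The first time (possibly `∞`, possibly `0`) at which the trajectory `ω` is at `j`. -/
noncomputable def firstVisit (j : Fin n) (ω : ℕ → Fin n) : ℝ≥0∞ :=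
  ⨅ (t : ℕ) (_ : ω t = j), (t : ℝ≥0∞)

/-- The hitting time `H(i, j)`: the expected first time at which the walk from `i` visits `j`. -/
noncomputable def hittingTime (i j : Fin n) : ℝ≥0∞ :=
  ∫⁻ ω, firstVisit j ω ∂(G.walkLaw i)

/-- Kemeny's constant `∑_j π_j H(i, j)`, computed from the starting vertex `i`. -/
noncomputable def kemeny (i : Fin n) : ℝ≥0∞ :=
  ∑ j, ENNReal.ofReal (G.stationary j) * G.hittingTime i j

/-- The escape probability: the probability that the walk from `i` reaches `j` before it
returns to `i`. -/
noncomputable def escapeProb (i j : Fin n) : ℝ :=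
  (G.walkLaw i).real {ω | ∃ t, 1 ≤ t ∧ ω t = j ∧ ∀ s, 1 ≤ s → s < t → ω s ≠ i}

/-- The resistance distance `Ω(i, j)`. -/
noncomputable def resistance (i j : Fin n) : ℝ :=
  if i = j then 0 else 1 / (G.volume * G.stationary i * G.escapeProb i j)

/-- The Kirchhoff index `R(G)`. -/
noncomputable def kirchhoff : ℝ := ∑ i, ∑ j ∈ Finset.Ioi i, G.resistance i j

/-- The multiplicative Kirchhoff index `R*(G)`. -/
noncomputable def mulKirchhoff : ℝ :=
  G.volume ^ 2 *
    ∑ i, ∑ j ∈ Finset.Ioi i, G.stationary i * G.stationary j * G.resistance i j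

/-- The Laplacian `L = d_G Π (I - P)`. -/
noncomputable def laplacian : Matrix (Fin n) (Fin n) ℝ :=
  G.volume • (Matrix.diagonal G.stationary * (1 - G.transition))

/-- The normalized Laplacian `(Π^{-1/2} / √d_G) L (Π^{-1/2} / √d_G)`. -/
noncomputable def normalizedLaplacian : Matrix (Fin n) (Fin n) ℝ :=
  Matrix.diagonal (fun i => (√(G.stationary i))⁻¹ / √G.volume) * G.laplacian *
    Matrix.diagonal (fun i => (√(G.stationary i))⁻¹ / √G.volume)

end StronglyConnectedDigraph

/-!
A group inverse `X` of a square matrix `A` (`A X A = A`, `X A X = X`, `A X = X A`) is carried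
along by similarity, its trace is the sum of the inverses of the nonzero eigenvalues of `A`, and it
is the Moore–Penrose inverse as soon as the projection `A X` is symmetric. Let `M` and `D` be the
group inverses of `L` and `I - P`. Since `L` kills constants on both sides, `L M` is the orthogonal
projection along `1`, so `M = L†`. Since `L̃ = Π^{1/2} (I - P) Π^{-1/2}` and
`(I - P) D = I - 1 πᵀ`, the conjugate `Π^{1/2} D Π^{-1/2}` is `L̃†`, so `Tr L̃† = Tr D`.

If `v k` is the probability that the walk from `k` reaches `j` before `i`, then
`L v = d π_i P_es(i, j) (e_j - e_i)`, and the kernel of `L` is the constants. Hence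
`Ω(i, j) = X_ii + X_jj - X_ij - X_ji` for every `{1}`-inverse `X` of `L`. Summing over pairs with
`X = L†`, whose row sums vanish, gives `R = n Tr L†`; weighting the pairs by `π_i π_j`
and taking `X = d⁻¹ D Π⁻¹`, which annihilates `π`, gives `R* = d Tr D`. Finally
`H(i, j) = (D_jj - D_ij) / π_j` solves the one-step equations for the hitting times, so that
`K = Tr D` because `D 1 = 0`.
-/

open Matrix Polynomial

/-! ### Group inverses -/

section GroupInverse

/-- `x` is the group inverse of `a`: the inverse of `a` in the multiplicative group of some
idempotent that commutes with `a`. For a matrix with range and kernel complementary it replaces the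
Moore–Penrose inverse in a similarity-invariant way. -/
structure IsGroupInverse {M : Type*} [Mul M] (a x : M) : Prop where
  mul_mul_self : a * x * a = a
  inv_mul_mul : x * a * x = x
  mul_comm : a * x = x * a

namespace IsGroupInverse

theorem conj {M : Type*} [Monoid M] {a x : M} (h : IsGroupInverse a x) (u : Mˣ) :
    IsGroupInverse (u * a * ↑u⁻¹) (u * x * ↑u⁻¹) where
  mul_mul_self := by simpa [mul_assoc] using congrArg (fun b : M => ↑u * b * ↑u⁻¹) h.mul_mul_self
  inv_mul_mul := by simpa [mul_assoc] using congrArg (fun b : M => ↑u * b * ↑u⁻¹) h.inv_mul_mul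
  mul_comm := by simpa [mul_assoc] using congrArg (fun b : M => ↑u * b * ↑u⁻¹) h.mul_comm

theorem map {M N F : Type*} [Mul M] [Mul N] [FunLike F M N] [MulHomClass F M N]
    {a x : M} (h : IsGroupInverse a x) (f : F) : IsGroupInverse (f a) (f x) where
  mul_mul_self := by simp only [← map_mul, h.mul_mul_self]
  inv_mul_mul := by simp only [← map_mul, h.inv_mul_mul]
  mul_comm := by simp only [← map_mul, h.mul_comm]

variable {R : Type*} [Ring R] {a x : R}

theorem isIdempotentElem_one_sub (h : IsGroupInverse a x) : IsIdempotentElem (1 - a * x) :=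
  IsIdempotentElem.one_sub <| by rw [IsIdempotentElem, ← mul_assoc, h.mul_mul_self]

theorem mul_one_sub (h : IsGroupInverse a x) : a * (1 - a * x) = 0 := by
  rw [h.mul_comm, mul_sub, mul_one, ← mul_assoc, h.mul_mul_self, sub_self]

theorem one_sub_mul (h : IsGroupInverse a x) : (1 - a * x) * x = 0 := by
  rw [h.mul_comm, sub_mul, one_mul, h.inv_mul_mul, sub_self]

theorem add_one_sub_mul_add_one_sub (h : IsGroupInverse a x) :
    (a + (1 - a * x)) * (x + (1 - a * x)) = 1 := by
  rw [add_mul, mul_add, mul_add, h.mul_one_sub, h.one_sub_mul, h.isIdempotentElem_one_sub.eq]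
  abel

theorem exists_of_isUnit_add {q : R} (hq : IsIdempotentElem q) (haq : a * q = 0)
    (hqa : q * a = 0) (hu : IsUnit (a + q)) : ∃ x, IsGroupInverse a x ∧ a * x = 1 - q := by
  obtain ⟨u, hu⟩ := hu
  have ha : a = u - q := by rw [hu, add_sub_cancel_right]
  have huq : ↑u⁻¹ * q = q := by
    rw [Units.inv_mul_eq_iff_eq_mul, hu, add_mul, haq, hq.eq, zero_add]
  have hqu : q * ↑u⁻¹ = q := by
    rw [Units.mul_inv_eq_iff_eq_mul, hu, mul_add, hqa, hq.eq, zero_add]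
  have hax : a * (↑u⁻¹ - q) = 1 - q := by
    rw [mul_sub, haq, ha, sub_mul, u.mul_inv, hqu, sub_zero]
  have hxa : (↑u⁻¹ - q) * a = 1 - q := by
    rw [sub_mul, hqa, ha, mul_sub, u.inv_mul, huq, sub_zero]
  refine ⟨↑u⁻¹ - q, ⟨?_, ?_, hax.trans hxa.symm⟩, hax⟩
  · rw [hax, sub_mul, one_mul, hqa, sub_zero]
  · rw [hxa, sub_mul, one_mul, mul_sub, hqu, hq.eq, sub_self, sub_zero]

end IsGroupInverse
end GroupInverse

section Eigenvalues

variable {ι : Type*} [Fintype ι] [DecidableEq ι]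

theorem charpoly_mul_charpoly_of_mul_eq_zero {R : Type*} [CommRing R] {A B : Matrix ι ι R}
    (h : A * B = 0) :
    A.charpoly * B.charpoly = X ^ Fintype.card ι * (A + B).charpoly := by
  have hC : A.map C * B.map C = 0 := by
    rw [← Matrix.map_mul, h, Matrix.map_zero _ C_0]
  have hmul : A.charmatrix * B.charmatrix = (X : R[X]) • (A + B).charmatrix := by
    simp only [charmatrix, RingHom.mapMatrix_apply, Matrix.map_add _ (map_add C),
      scalar_apply, ← smul_one_eq_diagonal, sub_mul, mul_sub, hC, smul_mul_assoc, one_mul,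
      mul_smul_comm, mul_one, smul_sub, smul_add]
    abel
  rw [charpoly, charpoly, ← det_mul, hmul, det_smul, charpoly]

section Field

variable {K : Type*} [Field K] {A B : Matrix ι ι K}

/-- Zero eigenvalues do not contribute, since `0⁻¹ = 0`. -/
theorem sum_inv_roots_charpoly_add (h : A * B = 0) :
    ((A + B).charpoly.roots.map (·⁻¹)).sum =
      (A.charpoly.roots.map (·⁻¹)).sum + (B.charpoly.roots.map (·⁻¹)).sum := by
  have hroots := congrArg roots (charpoly_mul_charpoly_of_mul_eq_zero h)
  rw [roots_mul (mul_ne_zero A.charpoly_monic.ne_zero B.charpoly_monic.ne_zero),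
    roots_mul (mul_ne_zero (pow_ne_zero _ X_ne_zero) (A + B).charpoly_monic.ne_zero),
    roots_pow, roots_X] at hroots
  simpa [Multiset.map_nsmul, Multiset.sum_nsmul] using
    (congrArg (fun s : Multiset K => (s.map (·⁻¹)).sum) hroots).symm

variable [IsAlgClosed K]

theorem sum_inv_roots_charpoly_of_isIdempotentElem (h : IsIdempotentElem A) :
    (A.charpoly.roots.map (·⁻¹)).sum = A.trace := by
  have hinv : ∀ z ∈ A.charpoly.roots, z⁻¹ = z := fun z hz => by
    have hz' := h.spectrum_subset K (mem_spectrum_iff_isRoot_charpoly.2 (isRoot_of_mem_roots hz))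
    rcases hz' with rfl | rfl <;> simp
  rw [Multiset.map_congr rfl hinv, Multiset.map_id', trace_eq_sum_roots_charpoly]

theorem sum_inv_roots_charpoly_of_mul_eq_one (h : A * B = 1) :
    (A.charpoly.roots.map (·⁻¹)).sum = B.trace := by
  have hB : IsUnit B := .of_mul_eq_one_right A h
  have hcharpoly : A.charpoly = C ((-1) ^ Fintype.card ι * B.det⁻¹) * B.charpolyRev := by
    rw [← inv_eq_left_inv h, charpoly_inv B hB]
    simp
  have hc : (-1) ^ Fintype.card ι * B.det⁻¹ ≠ 0 :=
    mul_ne_zero (by simp) (inv_ne_zero ((isUnit_iff_isUnit_det B).1 hB).ne_zero)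
  have heval : A.charpoly.eval 0 ≠ 0 := by simpa [hcharpoly] using hc
  -- The sum is minus the logarithmic derivative of the characteristic polynomial at `0`.
  have hlog := (IsAlgClosed.splits A.charpoly).eval_derivative_div_eval_of_ne_zero heval
  have hderiv : B.charpolyRev.derivative.eval 0 = -B.trace := by
    rw [← coeff_zero_eq_eval_zero, coeff_derivative, zero_add, coeff_charpolyRev_eq_neg_trace]
    simp
  simp_rw [zero_sub, one_div, inv_neg] at hlog
  rw [Multiset.sum_map_neg, hcharpoly, derivative_C_mul, eval_C_mul, eval_C_mul,
    mul_div_mul_left _ _ hc, hderiv, eval_charpolyRev, div_one, ← hcharpoly] at hlog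
  exact neg_injective hlog.symm

theorem IsGroupInverse.sum_inv_roots_charpoly (h : IsGroupInverse A B) :
    (A.charpoly.roots.map (·⁻¹)).sum = B.trace := by
  have hadd := sum_inv_roots_charpoly_add h.mul_one_sub
  rw [sum_inv_roots_charpoly_of_mul_eq_one h.add_one_sub_mul_add_one_sub,
     sum_inv_roots_charpoly_of_isIdempotentElem h.isIdempotentElem_one_sub, trace_add] at hadd
  exact (add_right_cancel hadd).symm

end Field
end Eigenvalues

section MoorePenrose

variable {n : ℕ} {A X Y : Matrix (Fin n) (Fin n) ℝ}

theorem IsMoorePenroseInverse.transpose (h : IsMoorePenroseInverse A X) :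
    IsMoorePenroseInverse Aᵀ Xᵀ where
  mul_mul_self := by simpa [Matrix.mul_assoc] using congrArg Matrix.transpose h.mul_mul_self
  inv_mul_mul := by simpa [Matrix.mul_assoc] using congrArg Matrix.transpose h.inv_mul_mul
  symm_left := by rw [← transpose_mul, h.symm_right, h.symm_right]
  symm_right := by rw [← transpose_mul, h.symm_left, h.symm_left]

theorem IsMoorePenroseInverse.mul_eq_mul (hX : IsMoorePenroseInverse A X)
    (hY : IsMoorePenroseInverse A Y) : A * X = A * Y :=
  calc A * X = (A * Y * (A * X))ᵀ := by
        rw [← Matrix.mul_assoc, hY.mul_mul_self, hX.symm_left]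
    _ = A * X * (A * Y) := by rw [transpose_mul, hX.symm_left, hY.symm_left]
    _ = A * Y := by rw [← Matrix.mul_assoc, hX.mul_mul_self]

theorem IsMoorePenroseInverse.unique (hX : IsMoorePenroseInverse A X)
    (hY : IsMoorePenroseInverse A Y) : X = Y := by
  have hleft : A * X = A * Y := hX.mul_eq_mul hY
  have hright : X * A = Y * A := by
    simpa [← transpose_mul] using hX.transpose.mul_eq_mul hY.transpose
  rw [← hX.inv_mul_mul, hright, Matrix.mul_assoc, hleft, ← Matrix.mul_assoc, hY.inv_mul_mul]

theorem IsMoorePenroseInverse.pseudoinverse_eq (hX : IsMoorePenroseInverse A X) :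
    pseudoinverse A = X :=
  IsMoorePenroseInverse.unique (Classical.epsilon_spec ⟨X, hX⟩) hX

theorem IsGroupInverse.pseudoinverse_eq (h : IsGroupInverse A X) (hsymm : (A * X)ᵀ = A * X) :
    pseudoinverse A = X :=
  IsMoorePenroseInverse.pseudoinverse_eq
    ⟨h.mul_mul_self, h.inv_mul_mul, hsymm, by rw [← h.mul_comm, hsymm]⟩

theorem IsGroupInverse.sumInvNonzeroEigenvalues_eq (h : IsGroupInverse A X) :
    sumInvNonzeroEigenvalues A = X.trace := by
  have hsum := (h.map Complex.ofRealHom.mapMatrix).sum_inv_roots_charpoly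
  have hzero : ∀ s : Multiset ℂ, ((s.filter (· = 0)).map (·⁻¹)).sum = 0 := fun s => by
    simp [Multiset.filter_eq']
  rw [← Multiset.filter_add_not (· = 0) (charpoly _).roots, Multiset.map_add, Multiset.sum_add,
    hzero, zero_add] at hsum
  simp only [sumInvNonzeroEigenvalues, one_div]
  exact hsum.trans (AddMonoidHom.map_trace Complex.ofRealHom.toAddMonoidHom X).symm

end MoorePenrose

section Kernel

variable {ι : Type*} [Fintype ι]

theorem IsGroupInverse.mulVec_eq_zero {R : Type*} [Semiring R] {A X : Matrix ι ι R} {v : ι → R}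
    (h : IsGroupInverse A X) (hv : A *ᵥ v = 0) : X *ᵥ v = 0 := by
  rw [← h.inv_mul_mul, Matrix.mul_assoc, h.mul_comm, ← mulVec_mulVec, ← mulVec_mulVec, hv,
    mulVec_zero, mulVec_zero]

theorem exists_isGroupInverse_of_ker_le_span [DecidableEq ι] {K : Type*} [Field K]
    {A : Matrix ι ι K} {v w : ι → K} (hwv : w ⬝ᵥ v = 1) (hAv : A *ᵥ v = 0) (hwA : w ᵥ* A = 0)
    (hker : ∀ x, A *ᵥ x = 0 → ∃ c : K, c • v = x) :
    ∃ X, IsGroupInverse A X ∧ A * X = 1 - vecMulVec v w := by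
  have hidem : IsIdempotentElem (vecMulVec v w) := by
    rw [IsIdempotentElem, vecMulVec_mul_vecMulVec, hwv, one_smul]
  have hinj : ∀ x, (A + vecMulVec v w) *ᵥ x = 0 → x = 0 := fun x hx => by
    have hsum : A *ᵥ x + (w ⬝ᵥ x) • v = 0 := by
      simpa [add_mulVec, vecMulVec_mulVec] using hx
    have hwx : w ⬝ᵥ x = 0 := by
      simpa [dotProduct_mulVec, hwA, hwv] using congrArg (w ⬝ᵥ ·) hsum
    obtain ⟨c, rfl⟩ := hker x (by simpa [hwx] using hsum)
    simp_all
  refine IsGroupInverse.exists_of_isUnit_add hidem ?_ ?_ ?_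
  · rw [mul_vecMulVec, hAv, zero_vecMulVec]
  · rw [vecMulVec_mul, hwA, vecMulVec_zero]
  · rw [isUnit_iff_isUnit_det, isUnit_iff_ne_zero]
    intro hdet
    obtain ⟨x, hx0, hx⟩ := exists_mulVec_eq_zero_iff.2 hdet
    exact hx0 (hinj x hx)

end Kernel

theorem sum_Ioi_mul_diag_sub {ι R : Type*} [Fintype ι] [LinearOrder ι] [LocallyFiniteOrderTop ι]
    [LocallyFiniteOrderBot ι] [CommRing R] (a : ι → R) (M : Matrix ι ι R) :
    ∑ i, ∑ j ∈ Finset.Ioi i, a i * a j * (M i i + M j j - M i j - M j i) =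
      (∑ i, a i) * ∑ i, a i * M i i - a ⬝ᵥ M *ᵥ a := by
  have hdiag : ∀ i, ∑ j ∈ ({i} : Finset ι)ᶜ, a j * a i * (M j j - M j i) =
      ∑ j, a j * a i * (M j j - M j i) := fun i => by
    rw [Fintype.sum_eq_add_sum_compl i, sub_self, mul_zero, zero_add]
  calc _ = ∑ i, ∑ j ∈ Finset.Ioi i,
        (a j * a i * (M j j - M j i) + a i * a j * (M i i - M i j)) :=
        Finset.sum_congr rfl fun i _ => Finset.sum_congr rfl fun j _ => by ring
    _ = ∑ i, ∑ j, a j * a i * (M j j - M j i) := by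
        rw [Finset.sum_sum_Ioi_add_eq_sum_sum_off_diag fun i j => a i * a j * (M i i - M i j)]
        exact Finset.sum_congr rfl fun i _ => hdiag i
    _ = ∑ j, ∑ i, a j * a i * (M j j - M j i) := Finset.sum_comm
    _ = _ := by
        rw [mul_comm, Finset.sum_mul_sum]
        simp only [dotProduct, mulVec, Finset.mul_sum, ← Finset.sum_sub_distrib]
        exact Finset.sum_congr rfl fun i _ => Finset.sum_congr rfl fun j _ => by ring

/-! ### Stochastic matrices -/

section Stochastic

theorem isIrreducible_of_transGen {ι R : Type*} [Ring R] [LinearOrder R] {P : Matrix ι ι R}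
    (hP : ∀ i j, 0 ≤ P i j) (h : ∀ i j, Relation.TransGen (fun a b => 0 < P a b) i j) :
    P.IsIrreducible := by
  let : Quiver ι := toQuiver P
  refine ⟨hP, fun i j => ?_⟩
  induction h i j with
  | single h => exact ⟨.cons .nil ⟨h⟩, Nat.succ_pos _⟩
  | tail _ h ih =>
    obtain ⟨walk, -⟩ := ih
    exact ⟨.cons walk ⟨h⟩, Nat.succ_pos _⟩

variable {ι R : Type*} [Fintype ι] [Field R] {P : Matrix ι ι R} {p x : ι → R}

theorem mulVec_eq_self_of_forall_ne (hp : p ᵥ* P = p) {j : ι} (hj : p j ≠ 0)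
    (hx : ∀ i ≠ j, (P *ᵥ x) i = x i) : P *ᵥ x = x := by
  have hsum : ∑ i, p i * ((P *ᵥ x) i - x i) = 0 := by
    have hdot : p ⬝ᵥ P *ᵥ x = p ⬝ᵥ x := by rw [dotProduct_mulVec, hp]
    simp only [mul_sub, Finset.sum_sub_distrib, sub_eq_zero]
    exact hdot
  rw [Finset.sum_eq_single j (fun i _ hi => by rw [hx i hi, sub_self, mul_zero]) (by simp)] at hsum
  have hxj := sub_eq_zero.1 ((mul_eq_zero.1 hsum).resolve_left hj)
  classical exact funext fun i => (eq_or_ne i j).elim (fun h => h ▸ hxj) (hx i)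

variable [DecidableEq ι]

theorem vecMul_pow_eq_self (h : p ᵥ* P = p) (k : ℕ) : p ᵥ* P ^ k = p := by
  induction k with
  | zero => simp
  | succ k ih => rw [pow_succ, ← vecMul_vecMul, ih, h]

theorem mulVec_pow_eq_self (h : P *ᵥ x = x) (k : ℕ) : P ^ k *ᵥ x = x := by
  induction k with
  | zero => simp
  | succ k ih => rw [pow_succ, ← mulVec_mulVec, h, ih]

variable [LinearOrder R] [IsStrictOrderedRing R]

theorem eq_of_mulVec_eq_self (hP : P ∈ rowStochastic R ι) (hirr : P.IsIrreducible)
    (hx : P *ᵥ x = x) (i j : ι) : x i = x j := by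
  have : Nonempty ι := ⟨i⟩
  obtain ⟨m, hm⟩ := Finite.exists_max x
  suffices hmax : ∀ j, x j = x m by rw [hmax i, hmax j]
  intro j
  obtain ⟨k, -, hpos⟩ := (isIrreducible_iff_exists_pow_pos hP.1).1 hirr m j
  have hPk : P ^ k ∈ rowStochastic R ι := pow_mem hP k
  have hsum : ∑ l, (P ^ k) m l * (x m - x l) = 0 := by
    have hxm : ∑ l, (P ^ k) m l * x l = x m := congrFun (mulVec_pow_eq_self hx k) m
    simp only [mul_sub, Finset.sum_sub_distrib, ← Finset.sum_mul, hxm,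
      sum_row_of_mem_rowStochastic hPk, one_mul, sub_self]
  have hterm := (Finset.sum_eq_zero_iff_of_nonneg fun l _ =>
    mul_nonneg (hPk.1 m l) (sub_nonneg.2 (hm l))).1 hsum j (Finset.mem_univ j)
  exact (sub_eq_zero.1 ((mul_eq_zero.1 hterm).resolve_left hpos.ne')).symm

theorem abs_vecMul_eq_self (hP : P ∈ rowStochastic R ι) (hp : p ᵥ* P = p) : |p| ᵥ* P = |p| := by
  have hle : ∀ j ∈ Finset.univ, |p| j ≤ (|p| ᵥ* P) j := fun j _ =>
    calc |p| j = |∑ i, p i * P i j| := by rw [Pi.abs_apply, ← congrFun hp j]; rfl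
      _ ≤ ∑ i, |p i * P i j| := Finset.abs_sum_le_sum_abs _ _
      _ = (|p| ᵥ* P) j := by simp only [abs_mul, abs_of_nonneg (hP.1 _ j)]; rfl
  have hsum : |p| ⬝ᵥ 1 = (|p| ᵥ* P) ⬝ᵥ 1 := by rw [← dotProduct_mulVec, hP.2]
  simp only [dotProduct_one] at hsum
  exact funext fun j => ((Finset.sum_eq_sum_iff_of_le hle).1 hsum j (Finset.mem_univ j)).symm

theorem exists_vecMul_eq_self [Nonempty ι] (hP : P ∈ rowStochastic R ι) :
    ∃ p, p ᵥ* P = p ∧ ∑ i, p i = 1 := by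
  have hdet : (1 - P).det = 0 :=
    exists_mulVec_eq_zero_iff.1 ⟨1, one_ne_zero, by rw [sub_mulVec, one_mulVec, hP.2, sub_self]⟩
  obtain ⟨p, hp0, hp⟩ := exists_vecMul_eq_zero_iff.2 hdet
  rw [vecMul_sub, vecMul_one, sub_eq_zero] at hp
  have hsum : ∑ i, |p| i ≠ 0 := fun h => hp0 <| funext fun i => abs_eq_zero.1 <|
    (Finset.sum_eq_zero_iff_of_nonneg fun i _ => abs_nonneg (p i)).1 h i (Finset.mem_univ i)
  refine ⟨(∑ i, |p| i)⁻¹ • |p|, ?_, ?_⟩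
  · rw [smul_vecMul, abs_vecMul_eq_self hP hp.symm]
  · simp only [Pi.smul_apply, smul_eq_mul, ← Finset.mul_sum, inv_mul_cancel₀ hsum]

theorem pos_of_vecMul_eq_self (hP : P ∈ rowStochastic R ι) (hirr : P.IsIrreducible)
    (hp : p ᵥ* P = p) {i : ι} (hi : 0 < p i) (j : ι) : 0 < p j := by
  obtain ⟨k, -, hpos⟩ := (isIrreducible_iff_exists_pow_pos hP.1).1 hirr i j
  -- `|p| + p` is fixed, nonnegative, and positive exactly where `p` is.
  have hfix : (|p| + p) ᵥ* P ^ k = |p| + p :=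
    vecMul_pow_eq_self (by rw [add_vecMul, abs_vecMul_eq_self hP hp, hp]) k
  have hnonneg : ∀ l, 0 ≤ (|p| + p) l := fun l => by
    simpa [add_comm] using neg_le_iff_add_nonneg.1 (neg_abs_le (p l))
  have hj : 0 < (|p| + p) j := by
    rw [← hfix]
    exact Finset.sum_pos' (fun l _ => mul_nonneg (hnonneg l) (pow_apply_nonneg hP.1 k l j))
      ⟨i, Finset.mem_univ i, mul_pos (by simpa [abs_of_pos hi]) hpos⟩
  by_contra! hneg
  simp [abs_of_nonpos hneg] at hj

theorem nonneg_of_mulVec_lt (hP : P ∈ rowStochastic R ι) {j : ι} (hj : 0 ≤ x j)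
    (hx : ∀ i ≠ j, (P *ᵥ x) i < x i) (i : ι) : 0 ≤ x i := by
  have : Nonempty ι := ⟨i⟩
  obtain ⟨m, hm⟩ := Finite.exists_min x
  suffices hmj : m = j from hj.trans (hmj ▸ hm i)
  by_contra hne
  refine (hx m hne).not_ge ?_
  calc x m = ∑ k, P m k * x m := by
        rw [← Finset.sum_mul, sum_row_of_mem_rowStochastic hP, one_mul]
    _ ≤ ∑ k, P m k * x k :=
        Finset.sum_le_sum fun k _ => mul_le_mul_of_nonneg_left (hm k) (hP.1 m k)

theorem exists_isGroupInverse_one_sub (hP : P ∈ rowStochastic R ι) (hirr : P.IsIrreducible)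
    (hp : p ᵥ* P = p) (hsum : ∑ i, p i = 1) :
    ∃ D, IsGroupInverse (1 - P) D ∧ (1 - P) * D = 1 - vecMulVec 1 p := by
  refine exists_isGroupInverse_of_ker_le_span ?_ ?_ ?_ fun x hx => ?_
  · rwa [dotProduct_one]
  · rw [sub_mulVec, one_mulVec, hP.2, sub_self]
  · rw [vecMul_sub, vecMul_one, hp, sub_self]
  · rw [sub_mulVec, one_mulVec, sub_eq_zero] at hx
    obtain ⟨i, -, -⟩ := Finset.exists_ne_zero_of_sum_ne_zero (hsum.trans_ne one_ne_zero)
    exact ⟨x i, funext fun j => by simp [eq_of_mulVec_eq_self hP hirr hx.symm i j]⟩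

end Stochastic

/-! ### The random walk -/

section Trajectories

variable {S : Type*}

/-- The trajectory that starts at `i` and continues as `ω`. -/
def consPath (i : S) (ω : ℕ → S) : ℕ → S
  | 0 => i
  | t + 1 => ω t

theorem consPath_preimage_cylinder_succ [DecidableEq S] (i : S) (x : ℕ → S) (t : ℕ) :
    consPath i ⁻¹' PiNat.cylinder x (t + 1) =
      if x 0 = i then PiNat.cylinder (fun s => x (s + 1)) t else ∅ := by
  ext ω
  simp only [Set.mem_preimage, PiNat.mem_cylinder_iff, Nat.forall_lt_succ_left, consPath]
  split_ifs with h <;> simp [h, PiNat.mem_cylinder_iff, eq_comm (a := i)]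

theorem cylinder_succ_eq_preimage (x : ℕ → S) (t : ℕ) :
    PiNat.cylinder x (t + 1) =
      Preorder.frestrictLe (π := fun _ => S) t ⁻¹' {Preorder.frestrictLe t x} := by
  ext ω
  simp [PiNat.mem_cylinder_iff, funext_iff]

/-- The event that a trajectory reaches `j` before it visits `i`. -/
def reachesBefore (i j : S) : Set (ℕ → S) := {ω | ∃ t, ω t = j ∧ ∀ s < t, ω s ≠ i}

theorem consPath_preimage_reachesBefore [DecidableEq S] (i j k : S) :
    consPath k ⁻¹' reachesBefore i j =
      if k = j then Set.univ else if k = i then ∅ else reachesBefore i j := by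
  ext ω
  have hsplit : consPath k ω ∈ reachesBefore i j ↔ k = j ∨ k ≠ i ∧ ω ∈ reachesBefore i j := by
    simp only [reachesBefore, Set.mem_ofPred_eq]
    rw [← Nat.or_exists_add_one]
    simp only [Nat.forall_lt_succ_left, Nat.not_lt_zero, false_implies, implies_true, and_true]
    simp only [consPath, and_left_comm (b := k ≠ i), exists_and_left]
  rw [Set.mem_preimage, hsplit]
  split_ifs <;> simp_all

variable [MeasurableSpace S]

theorem measurable_consPath (i : S) : Measurable (consPath i) :=
  measurable_pi_iff.2 fun
    | 0 => measurable_const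
    | t + 1 => measurable_pi_apply t

variable [MeasurableSingletonClass S]

theorem measurableSet_cylinder (x : ℕ → S) (t : ℕ) : MeasurableSet (PiNat.cylinder x t) := by
  rw [PiNat.cylinder_eq_pi]
  exact .pi (Finset.range t).countable_toSet fun s _ => measurableSet_singleton _

theorem measure_ext_of_cylinder [Countable S] {μ ν : Measure (ℕ → S)} [IsFiniteMeasure μ] (N : ℕ)
    (h : ∀ x, ∀ t ≥ N, μ (PiNat.cylinder x t) = ν (PiNat.cylinder x t)) : μ = ν := by
  have hμ : IsProjectiveMeasureFamily (α := fun _ : ℕ => S)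
      fun I : Finset ℕ => μ.map I.restrict := fun I J hJI => by
    rw [Measure.map_map (by fun_prop) (by fun_prop), Finset.restrict₂_comp_restrict]
  refine IsProjectiveLimit.unique (P := fun I : Finset ℕ => μ.map I.restrict) (fun I => rfl) ?_
  refine (isProjectiveLimit_nat_iff' hμ ν N).2 fun t ht => Measure.ext_of_singleton fun a => ?_
  obtain ⟨x, rfl⟩ : ∃ x : ℕ → S, Preorder.frestrictLe t x = a :=
    ⟨fun s => a ⟨min s t, by simp⟩, funext fun s => by
      simp [Preorder.frestrictLe_apply, min_eq_left (Finset.mem_Iic.1 s.2)]⟩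
  have hx := (h x (t + 1) (by omega)).symm
  rw [cylinder_succ_eq_preimage] at hx
  rwa [Measure.map_apply (Preorder.measurable_frestrictLe _) (measurableSet_singleton _),
    Measure.map_apply (by fun_prop) (measurableSet_singleton _)]

theorem measurableSet_reachesBefore (i j : S) : MeasurableSet (reachesBefore i j) := by
  unfold reachesBefore
  measurability

end Trajectories

namespace StronglyConnectedDigraph

variable {n : ℕ} (G : StronglyConnectedDigraph n)

theorem historyKernel_singleton (t : ℕ) (x : ℕ → Fin n) (j : Fin n) :
    G.historyKernel t (Preorder.frestrictLe t x) {j} = ENNReal.ofReal (G.transition (x t) j) := by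
  change (G.stepLaw (x t)).toMeasure {j} = _
  rw [PMF.toMeasure_apply_singleton _ _ (measurableSet_singleton _), stepLaw, PMF.ofFintype_apply]

instance isProbabilityMeasure_walkLaw (i : Fin n) : IsProbabilityMeasure (G.walkLaw i) := by
  unfold walkLaw
  infer_instance

theorem walkLaw_cylinder_succ (i : Fin n) (x : ℕ → Fin n) (t : ℕ) :
    G.walkLaw i (PiNat.cylinder x (t + 2)) =
      G.walkLaw i (PiNat.cylinder x (t + 1)) * ENNReal.ofReal (G.transition (x t) (x (t + 1))) := by
  have hprod := congrArg (· ({Preorder.frestrictLe t x} ×ˢ {x (t + 1)}))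
    (Kernel.partialTraj_compProd_eq_map_traj (X := fun _ => Fin n) (κ := G.historyKernel)
      (Nat.zero_le t) (x₀ := fun _ => i))
  have hset : (fun ω : ℕ → Fin n => (Preorder.frestrictLe (π := fun _ => Fin n) t ω, ω (t + 1))) ⁻¹'
      ({Preorder.frestrictLe t x} ×ˢ {x (t + 1)}) = PiNat.cylinder x (t + 2) := by
    rw [Set.mk_preimage_prod, ← cylinder_succ_eq_preimage]
    ext ω
    simp [PiNat.mem_cylinder_iff, Nat.forall_lt_succ_right]
  beta_reduce at hprod
  rw [Measure.map_apply (by fun_prop)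
    ((measurableSet_singleton _).prod (measurableSet_singleton _)), hset,
    Measure.compProd_apply_prod (measurableSet_singleton _) (measurableSet_singleton _),
    ← Kernel.traj_map_frestrictLe_apply, lintegral_singleton, historyKernel_singleton,
    Measure.map_apply (Preorder.measurable_frestrictLe t) (measurableSet_singleton _),
    ← cylinder_succ_eq_preimage, mul_comm] at hprod
  exact hprod.symm

theorem walkLaw_cylinder (i : Fin n) (x : ℕ → Fin n) (t : ℕ) :
    G.walkLaw i (PiNat.cylinder x (t + 1)) =
      if x 0 = i then ∏ s ∈ Finset.range t, ENNReal.ofReal (G.transition (x s) (x (s + 1)))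
      else 0 := by
  induction t with
  | zero =>
    rw [cylinder_succ_eq_preimage, ← Measure.map_apply (Preorder.measurable_frestrictLe 0)
      (measurableSet_singleton _), walkLaw, Kernel.traj_map_frestrictLe_apply,
      Kernel.partialTraj_self, Kernel.id_apply, Measure.dirac_apply' _ (measurableSet_singleton _)]
    simp [Set.indicator_apply, funext_iff, eq_comm]
  | succ t ih => rw [walkLaw_cylinder_succ, ih, Finset.prod_range_succ, ite_mul, zero_mul]

theorem walkLaw_eq_sum_smul_map (i : Fin n) :
    G.walkLaw i = ∑ k, ENNReal.ofReal (G.transition i k) • (G.walkLaw k).map (consPath i) := by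
  refine measure_ext_of_cylinder 2 fun x t ht => ?_
  obtain ⟨t, rfl⟩ := Nat.exists_eq_add_of_le' ht
  simp only [Measure.finsetSum_apply, Measure.smul_apply, smul_eq_mul,
    Measure.map_apply (measurable_consPath i) (measurableSet_cylinder _ _),
    consPath_preimage_cylinder_succ]
  split_ifs with h
  · simp [walkLaw_cylinder, Finset.prod_range_succ', h, mul_comm]
  · simp [walkLaw_cylinder, h]

theorem lintegral_walkLaw (i : Fin n) {f : (ℕ → Fin n) → ℝ≥0∞} (hf : Measurable f) :
    ∫⁻ ω, f ω ∂(G.walkLaw i) =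
      ∑ k, ENNReal.ofReal (G.transition i k) * ∫⁻ ω, f (consPath i ω) ∂(G.walkLaw k) := by
  rw [walkLaw_eq_sum_smul_map, lintegral_finsetSum_measure]
  simp only [lintegral_smul_measure, lintegral_map hf (measurable_consPath i), smul_eq_mul]

theorem transition_mem_rowStochastic : G.transition ∈ rowStochastic ℝ (Fin n) := by
  refine mem_rowStochastic_iff_sum.2
    ⟨fun i j => div_nonneg (G.weight_nonneg i j) (G.degree_pos i).le, fun i => ?_⟩
  simp only [transition, Matrix.of_apply, ← Finset.sum_div]
  exact div_self (G.degree_pos i).ne'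

theorem transition_nonneg (i j : Fin n) : 0 ≤ G.transition i j :=
  G.transition_mem_rowStochastic.1 i j

theorem walkLaw_real_apply (i : Fin n) {s : Set (ℕ → Fin n)} (hs : MeasurableSet s) :
    (G.walkLaw i).real s =
      (G.transition *ᵥ fun k => (G.walkLaw k).real (consPath i ⁻¹' s)) i := by
  rw [Measure.real, walkLaw_eq_sum_smul_map]
  simp only [Measure.finsetSum_apply, Measure.smul_apply, smul_eq_mul,
    Measure.map_apply (measurable_consPath i) hs]
  rw [ENNReal.toReal_sum
    (fun k _ => ENNReal.mul_ne_top ENNReal.ofReal_ne_top (measure_ne_top _ _))]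
  simp only [ENNReal.toReal_mul, ENNReal.toReal_ofReal (G.transition_nonneg _ _), Measure.real]
  rfl

theorem transition_isIrreducible : G.transition.IsIrreducible :=
  isIrreducible_of_transGen G.transition_nonneg fun i j =>
    Relation.TransGen.mono (fun a _ h => div_pos h (G.degree_pos a)) i j (G.connected i j)

theorem isStationary_stationary [NeZero n] : G.IsStationary G.stationary :=
  Classical.epsilon_spec (exists_vecMul_eq_self G.transition_mem_rowStochastic)

theorem stationary_pos [NeZero n] (j : Fin n) : 0 < G.stationary j := by
  have ⟨hfix, hsum⟩ := G.isStationary_stationary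
  obtain ⟨i, -, hi⟩ := Finset.exists_lt_of_sum_lt (s := Finset.univ) (f := 0) (g := G.stationary)
    (by simp [hsum])
  exact pos_of_vecMul_eq_self G.transition_mem_rowStochastic G.transition_isIrreducible hfix hi j

theorem volume_pos [NeZero n] : 0 < G.volume :=
  Finset.sum_pos (fun i _ => G.degree_pos i) Finset.univ_nonempty

/-- The probability that the walk from `k` reaches `j` before it visits `i`. -/
noncomputable def reachProb (i j k : Fin n) : ℝ := (G.walkLaw k).real (reachesBefore i j)

theorem reachProb_target (i j : Fin n) : G.reachProb i j j = 1 := by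
  rw [reachProb, walkLaw_real_apply _ _ (measurableSet_reachesBefore i j)]
  simpa [consPath_preimage_reachesBefore, mulVec, dotProduct] using
    sum_row_of_mem_rowStochastic G.transition_mem_rowStochastic j

theorem reachProb_source {i j : Fin n} (h : i ≠ j) : G.reachProb i j i = 0 := by
  rw [reachProb, walkLaw_real_apply _ _ (measurableSet_reachesBefore i j)]
  simp [consPath_preimage_reachesBefore, h, mulVec, dotProduct]

theorem transition_mulVec_reachProb {i j k : Fin n} (hi : k ≠ i) (hj : k ≠ j) :
    (G.transition *ᵥ G.reachProb i j) k = G.reachProb i j k := by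
  conv_rhs => rw [reachProb, walkLaw_real_apply _ _ (measurableSet_reachesBefore i j),
    consPath_preimage_reachesBefore, if_neg hj, if_neg hi]
  rfl

theorem escapeProb_eq (i j : Fin n) :
    G.escapeProb i j = (G.transition *ᵥ G.reachProb i j) i := by
  have hset : {ω : ℕ → Fin n | ∃ t, 1 ≤ t ∧ ω t = j ∧ ∀ s, 1 ≤ s → s < t → ω s ≠ i} =
      (fun ω t => ω (t + 1)) ⁻¹' reachesBefore i j := by
    ext ω
    have hforall : ∀ t, (∀ s, 1 ≤ s → s < t + 1 → ω s ≠ i) ↔ ∀ s < t, ω (s + 1) ≠ i := fun t => by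
      rw [← Nat.and_forall_add_one]
      simp
    simp only [reachesBefore, Set.mem_ofPred_eq, Set.mem_preimage, ← hforall]
    rw [← Nat.or_exists_add_one]
    simp
  have hshift : Measurable fun (ω : ℕ → Fin n) t => ω (t + 1) :=
    measurable_pi_lambda _ fun t => measurable_pi_apply (t + 1)
  rw [escapeProb, hset, walkLaw_real_apply _ _ (hshift (measurableSet_reachesBefore i j))]
  rfl

theorem measurable_firstVisit (j : Fin n) : Measurable (firstVisit j) :=
  Measurable.iInf fun t => (Measurable.of_discrete (f := fun x : Fin n => ⨅ _ : x = j,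
    (t : ℝ≥0∞))).comp (measurable_pi_apply t)

theorem firstVisit_consPath_self (j : Fin n) (ω : ℕ → Fin n) :
    firstVisit j (consPath j ω) = 0 :=
  le_antisymm (iInf₂_le_of_le 0 rfl (by simp)) zero_le

theorem firstVisit_consPath_of_ne {i j : Fin n} (h : i ≠ j) (ω : ℕ → Fin n) :
    firstVisit j (consPath i ω) = 1 + firstVisit j ω := by
  simp only [firstVisit]
  rw [← inf_iInf_nat_succ, ENNReal.add_iInf]
  simp only [consPath, h, iInf_false, top_inf_eq]
  refine iInf_congr fun t => ?_
  by_cases ht : ω t = j <;> simp [ht, add_comm]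

theorem hittingTime_self (j : Fin n) : G.hittingTime j j = 0 := by
  rw [hittingTime, lintegral_walkLaw _ _ (measurable_firstVisit j)]
  simp [firstVisit_consPath_self]

theorem lintegral_walkLaw_one_add (i : Fin n) {f : (ℕ → Fin n) → ℝ≥0∞} (hf : Measurable f)
    {g : (ℕ → Fin n) → ℝ≥0∞} (hg : ∀ ω, f (consPath i ω) = 1 + g ω) :
    ∫⁻ ω, f ω ∂(G.walkLaw i) =
      1 + ∑ k, ENNReal.ofReal (G.transition i k) * ∫⁻ ω, g ω ∂(G.walkLaw k) := by
  rw [lintegral_walkLaw _ _ hf]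
  simp only [hg, lintegral_add_left measurable_const, lintegral_const,
    measure_univ, mul_one, mul_add, Finset.sum_add_distrib, G.sum_ofReal_transition]

theorem hittingTime_of_ne {i j : Fin n} (h : i ≠ j) :
    G.hittingTime i j = 1 + ∑ k, ENNReal.ofReal (G.transition i k) * G.hittingTime k j :=
  G.lintegral_walkLaw_one_add i (measurable_firstVisit j) (firstVisit_consPath_of_ne h)

theorem hittingTime_le {j : Fin n} {g : Fin n → ℝ≥0∞}
    (hg : ∀ i ≠ j, 1 + ∑ k, ENNReal.ofReal (G.transition i k) * g k ≤ g i) (i : Fin n) :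
    G.hittingTime i j ≤ g i := by
  have hmeas : ∀ m : ℕ, Measurable fun ω : ℕ → Fin n => min (firstVisit j ω) m := fun m =>
    (measurable_firstVisit j).min measurable_const
  have htrunc : ∀ (m : ℕ) (i : Fin n), ∫⁻ ω, min (firstVisit j ω) m ∂(G.walkLaw i) ≤ g i := by
    intro m
    induction m with
    | zero => simp
    | succ m ih =>
      intro i
      rcases eq_or_ne i j with rfl | h
      · rw [lintegral_walkLaw _ _ (hmeas _)]
        simp [firstVisit_consPath_self]
      · rw [G.lintegral_walkLaw_one_add i (hmeas _) (g := fun ω => min (firstVisit j ω) m)]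
        · refine le_trans ?_ (hg i h)
          gcongr with k _
          exact ih k
        · intro ω
          rw [firstVisit_consPath_of_ne h, Nat.cast_succ, add_comm (m : ℝ≥0∞), min_add_add_left]
  have hsup : ∀ ω : ℕ → Fin n, firstVisit j ω = ⨆ m : ℕ, min (firstVisit j ω) m := fun ω => by
    rw [← inf_iSup_eq, ENNReal.iSup_natCast, inf_top_eq]
  rw [hittingTime, lintegral_congr hsup, lintegral_iSup hmeas]
  · exact iSup_le fun m => htrunc m i
  · exact fun a b hab ω => min_le_min_left _ (Nat.cast_le.2 hab)

theorem one_add_sum_ofReal_transition_mul {g : Fin n → ℝ} (hg : ∀ i, 0 ≤ g i) (i : Fin n) :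
    1 + ∑ k, ENNReal.ofReal (G.transition i k) * ENNReal.ofReal (g k) =
      ENNReal.ofReal (1 + (G.transition *ᵥ g) i) := by
  have hterm : ∀ k ∈ Finset.univ, 0 ≤ G.transition i k * g k := fun k _ =>
    mul_nonneg (G.transition_nonneg i k) (hg k)
  have hsum : (G.transition *ᵥ g) i = ∑ k, G.transition i k * g k := rfl
  rw [hsum, ENNReal.ofReal_add zero_le_one (Finset.sum_nonneg hterm), ENNReal.ofReal_one,
    ENNReal.ofReal_sum_of_nonneg hterm]
  simp only [ENNReal.ofReal_mul (G.transition_nonneg i _)]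

theorem nonneg_of_eq_one_add {j : Fin n} {g : Fin n → ℝ} (hj : g j = 0)
    (hg : ∀ i ≠ j, g i = 1 + (G.transition *ᵥ g) i) (i : Fin n) : 0 ≤ g i :=
  nonneg_of_mulVec_lt G.transition_mem_rowStochastic hj.ge
    (fun i hi => by linarith [hg i hi]) i

theorem hittingTime_eq_ofReal [NeZero n] {j : Fin n} {g : Fin n → ℝ} (hj : g j = 0)
    (hg : ∀ i ≠ j, g i = 1 + (G.transition *ᵥ g) i) (i : Fin n) :
    G.hittingTime i j = ENNReal.ofReal (g i) := by
  have hg0 := G.nonneg_of_eq_one_add hj hg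
  have hfin : ∀ i, G.hittingTime i j ≠ ⊤ := fun i => ne_top_of_le_ne_top ENNReal.ofReal_ne_top <|
    G.hittingTime_le (g := fun i => ENNReal.ofReal (g i)) (fun i hi => by
      rw [G.one_add_sum_ofReal_transition_mul hg0, ← hg i hi]) i
  set h : Fin n → ℝ := fun i => (G.hittingTime i j).toReal with hdef
  have hh : ∀ i ≠ j, h i = 1 + (G.transition *ᵥ h) i := fun i hi => by
    have hnonneg : 0 ≤ (G.transition *ᵥ h) i :=
      nonneg_mulVec_of_mem_rowStochastic G.transition_mem_rowStochastic
        (fun k => ENNReal.toReal_nonneg) i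
    rw [← ENNReal.toReal_ofReal (add_nonneg zero_le_one hnonneg),
      ← G.one_add_sum_ofReal_transition_mul fun k => ENNReal.toReal_nonneg]
    simp only [hdef, ENNReal.ofReal_toReal (hfin _), G.hittingTime_of_ne hi]
  have hharm : G.transition *ᵥ (g - h) = g - h :=
    mulVec_eq_self_of_forall_ne G.isStationary_stationary.1 (G.stationary_pos j).ne' fun i hi => by
      rw [mulVec_sub, Pi.sub_apply, Pi.sub_apply, hg i hi, hh i hi]
      ring
  have hconst : g i - h i = g j - h j :=
    eq_of_mulVec_eq_self G.transition_mem_rowStochastic G.transition_isIrreducible hharm i j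
  have hhj : h j = 0 := by simp [hdef, hittingTime_self]
  rw [← ENNReal.ofReal_toReal (hfin i), sub_eq_zero.1 (hconst.trans (by rw [hj, hhj, sub_zero]))]

/-! ### Resistance distances and the Laplacian -/

theorem laplacian_mulVec (x : Fin n → ℝ) (i : Fin n) :
    (G.laplacian *ᵥ x) i = G.volume * G.stationary i * (x i - (G.transition *ᵥ x) i) := by
  rw [laplacian, smul_mulVec, ← mulVec_mulVec, Pi.smul_apply, mulVec_diagonal, sub_mulVec,
    one_mulVec, Pi.sub_apply, smul_eq_mul, mul_assoc]

theorem laplacian_mulVec_one : G.laplacian *ᵥ 1 = 0 := by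
  ext i
  rw [laplacian_mulVec, G.transition_mem_rowStochastic.2, sub_self, mul_zero, Pi.zero_apply]

theorem one_vecMul_laplacian [NeZero n] : 1 ᵥ* G.laplacian = 0 := by
  have hdiag : 1 ᵥ* diagonal G.stationary = G.stationary := by
    ext i
    simp [vecMul_diagonal]
  rw [laplacian, vecMul_smul, ← vecMul_vecMul, hdiag, vecMul_sub, vecMul_one,
    G.isStationary_stationary.1, sub_self, smul_zero]

theorem eq_of_laplacian_mulVec_eq_zero [NeZero n] {x : Fin n → ℝ} (hx : G.laplacian *ᵥ x = 0)
    (i j : Fin n) : x i = x j := by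
  refine eq_of_mulVec_eq_self G.transition_mem_rowStochastic G.transition_isIrreducible
    (funext fun k => ?_) i j
  have hk : G.volume * G.stationary k * (x k - (G.transition *ᵥ x) k) = 0 := by
    rw [← laplacian_mulVec, hx, Pi.zero_apply]
  have hne := mul_ne_zero G.volume_pos.ne' (G.stationary_pos k).ne'
  exact (sub_eq_zero.1 ((mul_eq_zero.1 hk).resolve_left hne)).symm

/-- `reachProb i j` is the voltage that carries a current from `j` to `i`; its strength is
proportional to the escape probability. -/
theorem laplacian_mulVec_reachProb [NeZero n] {i j : Fin n} (hij : i ≠ j) :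
    G.laplacian *ᵥ G.reachProb i j =
      (G.volume * G.stationary i * G.escapeProb i j) • (Pi.single j 1 - Pi.single i 1) := by
  set y := G.laplacian *ᵥ G.reachProb i j +
    (G.volume * G.stationary i * G.escapeProb i j) • (Pi.single i 1 - Pi.single j 1) with hy
  have hne : ∀ k ≠ j, y k = 0 := fun k hkj => by
    rcases eq_or_ne k i with rfl | hki
    · simp [hy, laplacian_mulVec, reachProb_source _ hij, escapeProb_eq, hkj]
    · simp [hy, laplacian_mulVec, transition_mulVec_reachProb _ hki hkj, hki, hkj]
  have hsum : ∑ k, y k = 0 := by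
    rw [← one_dotProduct, hy, dotProduct_add, dotProduct_mulVec, one_vecMul_laplacian]
    simp
  have hyj : y j = 0 := by
    rwa [Finset.sum_eq_single j (fun k _ => hne k) (by simp)] at hsum
  have hy0 : y = 0 := funext fun k => (eq_or_ne k j).elim (fun h => h ▸ hyj) (hne k)
  rw [hy, add_eq_zero_iff_eq_neg] at hy0
  rw [hy0, ← smul_neg, neg_sub]

theorem resistance_eq [NeZero n] {M : Matrix (Fin n) (Fin n) ℝ}
    (hM : G.laplacian * M * G.laplacian = G.laplacian) (i j : Fin n) :
    G.resistance i j = M i i + M j j - M i j - M j i := by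
  rcases eq_or_ne i j with rfl | hij
  · simp [resistance]
  set c := G.volume * G.stationary i * G.escapeProb i j with hc
  set r := G.reachProb i j
  have hker : G.laplacian *ᵥ (M *ᵥ (G.laplacian *ᵥ r) - r) = 0 := by
    rw [mulVec_sub, mulVec_mulVec, mulVec_mulVec, hM, sub_self]
  have hdiff := G.eq_of_laplacian_mulVec_eq_zero hker j i
  rw [laplacian_mulVec_reachProb _ hij, ← hc] at hdiff
  have hunit : c * (M i i + M j j - M i j - M j i) = 1 := by
    simp only [r, mulVec_smul, mulVec_sub, mulVec_single_one, Pi.sub_apply, Pi.smul_apply,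
      smul_eq_mul, col_apply, reachProb_target, reachProb_source _ hij, sub_zero] at hdiff
    linarith
  rw [resistance, if_neg hij, ← hc, eq_comm, eq_one_div_of_mul_eq_one_right hunit]

theorem isGroupInverse_pseudoinverse_laplacian [NeZero n] :
    IsGroupInverse G.laplacian (pseudoinverse G.laplacian) := by
  obtain ⟨M, hM, hLM⟩ : ∃ M, IsGroupInverse G.laplacian M ∧
      G.laplacian * M = 1 - vecMulVec 1 ((n : ℝ)⁻¹ • 1) := by
    refine exists_isGroupInverse_of_ker_le_span ?_ G.laplacian_mulVec_one ?_ fun x hx => ?_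
    · simp [NeZero.ne n]
    · rw [smul_vecMul, one_vecMul_laplacian, smul_zero]
    · exact ⟨x 0, funext fun j => by simp [G.eq_of_laplacian_mulVec_eq_zero hx 0 j]⟩
  have hsymm : (G.laplacian * M)ᵀ = G.laplacian * M := by
    rw [hLM, transpose_sub, transpose_one, transpose_vecMulVec, vecMulVec_smul, smul_vecMulVec]
  rwa [hM.pseudoinverse_eq hsymm]

theorem kirchhoff_eq [NeZero n] : G.kirchhoff = n * (pseudoinverse G.laplacian).trace := by
  have hL := G.isGroupInverse_pseudoinverse_laplacian
  have hsum := sum_Ioi_mul_diag_sub 1 (pseudoinverse G.laplacian)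
  rw [hL.mulVec_eq_zero G.laplacian_mulVec_one, dotProduct_zero, sub_zero] at hsum
  simpa [kirchhoff, G.resistance_eq hL.mul_mul_self, trace] using hsum

/-! ### The deviation matrix -/

/-- The deviation matrix of the walk: the group inverse of `I - P`, whose complementary
projection is `1 πᵀ`. -/
noncomputable def deviation : Matrix (Fin n) (Fin n) ℝ :=
  Classical.epsilon fun D => IsGroupInverse (1 - G.transition) D ∧
    (1 - G.transition) * D = 1 - vecMulVec 1 G.stationary

section Deviation

variable [NeZero n]

theorem deviation_spec : IsGroupInverse (1 - G.transition) G.deviation ∧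
    (1 - G.transition) * G.deviation = 1 - vecMulVec 1 G.stationary :=
  Classical.epsilon_spec <| exists_isGroupInverse_one_sub G.transition_mem_rowStochastic
    G.transition_isIrreducible G.isStationary_stationary.1 G.isStationary_stationary.2

theorem isGroupInverse_deviation : IsGroupInverse (1 - G.transition) G.deviation :=
  G.deviation_spec.1

theorem one_sub_transition_mul_deviation :
    (1 - G.transition) * G.deviation = 1 - vecMulVec 1 G.stationary :=
  G.deviation_spec.2

theorem deviation_mulVec_one : G.deviation *ᵥ 1 = 0 :=
  G.isGroupInverse_deviation.mulVec_eq_zero <| by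
    rw [sub_mulVec, one_mulVec, G.transition_mem_rowStochastic.2, sub_self]

theorem laplacian_mul_deviation_mul_laplacian :
    G.laplacian * (G.volume⁻¹ • (G.deviation * diagonal G.stationary⁻¹)) * G.laplacian =
      G.laplacian := by
  have hdiag : diagonal G.stationary⁻¹ * diagonal G.stationary = 1 := by
    rw [diagonal_mul_diagonal, ← diagonal_one]
    exact congrArg diagonal (funext fun i => inv_mul_cancel₀ (G.stationary_pos i).ne')
  calc _ = G.volume • (diagonal G.stationary * ((1 - G.transition) * G.deviation *
        (diagonal G.stationary⁻¹ * diagonal G.stationary) * (1 - G.transition))) := by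
        simp [laplacian, Matrix.mul_assoc, smul_smul, G.volume_pos.ne', -diagonal_mul_diagonal]
    _ = G.laplacian := by
        rw [hdiag, Matrix.mul_one, G.isGroupInverse_deviation.mul_mul_self, laplacian]

theorem mulKirchhoff_eq : G.mulKirchhoff = G.volume * G.deviation.trace := by
  set M := G.volume⁻¹ • (G.deviation * diagonal G.stationary⁻¹) with hM
  have hMπ : M *ᵥ G.stationary = 0 := by
    have hdiag : diagonal G.stationary⁻¹ *ᵥ G.stationary = 1 := funext fun i => by
      simp [mulVec_diagonal, (G.stationary_pos i).ne']
    rw [hM, smul_mulVec, ← mulVec_mulVec, hdiag, deviation_mulVec_one, smul_zero]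
  have htrace : ∑ i, G.stationary i * M i i = G.volume⁻¹ * G.deviation.trace := by
    simp only [trace, diag, Finset.mul_sum]
    refine Finset.sum_congr rfl fun i _ => ?_
    rw [hM, Matrix.smul_apply, mul_diagonal, smul_eq_mul, Pi.inv_apply]
    field_simp [(G.stationary_pos i).ne']
  have hsum := sum_Ioi_mul_diag_sub G.stationary M
  rw [hMπ, dotProduct_zero, sub_zero, htrace, G.isStationary_stationary.2, one_mul] at hsum
  simp only [mulKirchhoff, G.resistance_eq G.laplacian_mul_deviation_mul_laplacian, ← hM, hsum]
  field_simp [G.volume_pos.ne']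

/-- `Π^{1/2}`, as an invertible matrix. -/
noncomputable def sqrtStationary : (Matrix (Fin n) (Fin n) ℝ)ˣ where
  val := diagonal fun i => √(G.stationary i)
  inv := diagonal fun i => (√(G.stationary i))⁻¹
  val_inv := by simp [(Real.sqrt_pos.2 (G.stationary_pos _)).ne']
  inv_val := by simp [(Real.sqrt_pos.2 (G.stationary_pos _)).ne']

theorem val_sqrtStationary : G.sqrtStationary.val = diagonal fun i => √(G.stationary i) :=
  rfl

theorem val_inv_sqrtStationary :
    G.sqrtStationary⁻¹.val = diagonal fun i => (√(G.stationary i))⁻¹ :=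
  rfl

theorem normalizedLaplacian_eq :
    G.normalizedLaplacian = G.sqrtStationary.val * (1 - G.transition) * G.sqrtStationary⁻¹.val := by
  ext i j
  have hπ := Real.mul_self_sqrt (G.stationary_pos i).le
  have hd := Real.mul_self_sqrt G.volume_pos.le
  have hπ0 := (Real.sqrt_pos.2 (G.stationary_pos i)).ne'
  have hd0 := (Real.sqrt_pos.2 G.volume_pos).ne'
  simp only [normalizedLaplacian, laplacian, val_sqrtStationary, val_inv_sqrtStationary,
    mul_diagonal, diagonal_mul, Matrix.smul_apply, smul_eq_mul]
  nth_rewrite 2 [← hπ]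
  nth_rewrite 2 [← hd]
  field_simp

theorem isGroupInverse_normalizedLaplacian : IsGroupInverse G.normalizedLaplacian
    (G.sqrtStationary.val * G.deviation * G.sqrtStationary⁻¹.val) := by
  rw [normalizedLaplacian_eq]
  exact G.isGroupInverse_deviation.conj _

theorem pseudoinverse_normalizedLaplacian : pseudoinverse G.normalizedLaplacian =
    G.sqrtStationary.val * G.deviation * G.sqrtStationary⁻¹.val := by
  have hmul : G.normalizedLaplacian *
      (G.sqrtStationary.val * G.deviation * G.sqrtStationary⁻¹.val) =
      1 - vecMulVec (fun i => √(G.stationary i)) fun i => √(G.stationary i) :=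
    calc _ = G.sqrtStationary.val * ((1 - G.transition) * G.deviation) *
          G.sqrtStationary⁻¹.val := by
          simp [normalizedLaplacian_eq, Matrix.mul_assoc]
      _ = _ := by
          rw [one_sub_transition_mul_deviation, Matrix.mul_sub, Matrix.sub_mul, Matrix.mul_one,
            Units.mul_inv, val_sqrtStationary, val_inv_sqrtStationary]
          ext i j
          simp [vecMulVec_apply, ← div_eq_mul_inv, mul_div_assoc, Real.div_sqrt]
  refine G.isGroupInverse_normalizedLaplacian.pseudoinverse_eq ?_
  rw [hmul, transpose_sub, transpose_one, transpose_vecMulVec]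

theorem trace_pseudoinverse_normalizedLaplacian :
    (pseudoinverse G.normalizedLaplacian).trace = G.deviation.trace := by
  rw [pseudoinverse_normalizedLaplacian, trace_units_conj]

theorem deviation_eq_add_transition_mul (i j : Fin n) :
    G.deviation i j = (1 : Matrix (Fin n) (Fin n) ℝ) i j - G.stationary j +
      (G.transition * G.deviation) i j := by
  have hij := congrFun₂ G.one_sub_transition_mul_deviation i j
  rw [Matrix.sub_mul, Matrix.one_mul] at hij
  simp only [Matrix.sub_apply, vecMulVec_apply, Pi.one_apply, one_mul] at hij
  linarith

theorem deviation_sub_div_eq_one_add {i j : Fin n} (hij : i ≠ j) :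
    (G.deviation j j - G.deviation i j) / G.stationary j =
      1 + (G.transition *ᵥ fun k => (G.deviation j j - G.deviation k j) / G.stationary j) i := by
  have hsum : (G.transition *ᵥ fun k => (G.deviation j j - G.deviation k j) / G.stationary j) i =
      (G.deviation j j - (G.transition * G.deviation) i j) / G.stationary j := by
    simp only [mulVec, dotProduct, mul_apply, mul_div_assoc', ← Finset.sum_div, mul_sub,
      Finset.sum_sub_distrib, ← Finset.sum_mul,
      sum_row_of_mem_rowStochastic G.transition_mem_rowStochastic, one_mul]
  have hj := G.stationary_pos j
  rw [hsum, G.deviation_eq_add_transition_mul i j, one_apply_ne hij]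
  field_simp
  ring

theorem hittingTime_eq (i j : Fin n) : G.hittingTime i j =
    ENNReal.ofReal ((G.deviation j j - G.deviation i j) / G.stationary j) :=
  G.hittingTime_eq_ofReal (g := fun i => (G.deviation j j - G.deviation i j) / G.stationary j)
    (by simp) (fun _ => G.deviation_sub_div_eq_one_add) i

theorem deviation_le_diag (i j : Fin n) : G.deviation i j ≤ G.deviation j j := by
  have hnonneg := G.nonneg_of_eq_one_add
    (g := fun i => (G.deviation j j - G.deviation i j) / G.stationary j)
    (by simp) (fun _ => G.deviation_sub_div_eq_one_add) i
  rwa [le_div_iff₀ (G.stationary_pos j), zero_mul, sub_nonneg] at hnonneg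

theorem trace_deviation_eq_sum (i : Fin n) :
    G.deviation.trace = ∑ j, (G.deviation j j - G.deviation i j) := by
  have hrow : ∑ j, G.deviation i j = 0 := by
    rw [← dotProduct_one]
    exact congrFun G.deviation_mulVec_one i
  rw [Finset.sum_sub_distrib, hrow, sub_zero]
  rfl

theorem trace_deviation_nonneg : 0 ≤ G.deviation.trace := by
  rw [G.trace_deviation_eq_sum 0]
  exact Finset.sum_nonneg fun j _ => sub_nonneg.2 (G.deviation_le_diag 0 j)

theorem kemeny_eq (i : Fin n) : G.kemeny i = ENNReal.ofReal G.deviation.trace := by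
  have hterm : ∀ j, ENNReal.ofReal (G.stationary j) * G.hittingTime i j =
      ENNReal.ofReal (G.deviation j j - G.deviation i j) := fun j => by
    rw [hittingTime_eq, ← ENNReal.ofReal_mul (G.stationary_pos j).le,
      mul_div_cancel₀ _ (G.stationary_pos j).ne']
  rw [G.trace_deviation_eq_sum i,
    ENNReal.ofReal_sum_of_nonneg fun j _ => sub_nonneg.2 (G.deviation_le_diag i j), kemeny]
  exact Finset.sum_congr rfl fun j _ => hterm j

end Deviation
end StronglyConnectedDigraph

theorem mainTheorem7 (n : ℕ) (G : StronglyConnectedDigraph n) :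
    (G.kirchhoff = n * (pseudoinverse G.laplacian).trace ∧
      (G.kirchhoff : ℂ) = n * sumInvNonzeroEigenvalues G.laplacian) ∧
    ((∀ i : Fin n, G.kemeny i ≠ ⊤ ∧ G.mulKirchhoff = G.volume * (G.kemeny i).toReal) ∧
      (G.mulKirchhoff : ℂ) = G.volume * sumInvNonzeroEigenvalues G.normalizedLaplacian ∧
      G.mulKirchhoff = G.volume * (pseudoinverse G.normalizedLaplacian).trace) := by
  rcases eq_or_ne n 0 with rfl | hn
  · simp [StronglyConnectedDigraph.kirchhoff, StronglyConnectedDigraph.mulKirchhoff,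
      StronglyConnectedDigraph.volume]
  have : NeZero n := ⟨hn⟩
  have hR := G.kirchhoff_eq
  have hRstar : G.mulKirchhoff = G.volume * (pseudoinverse G.normalizedLaplacian).trace := by
    rw [G.mulKirchhoff_eq, G.trace_pseudoinverse_normalizedLaplacian]
  have hL := G.isGroupInverse_pseudoinverse_laplacian.sumInvNonzeroEigenvalues_eq
  have hN := G.isGroupInverse_normalizedLaplacian.sumInvNonzeroEigenvalues_eq
  refine ⟨⟨hR, ?_⟩, fun i => ⟨?_, ?_⟩, ?_, hRstar⟩
  · rw [hL]
    exact_mod_cast hR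
  · rw [G.kemeny_eq]
    exact ENNReal.ofReal_ne_top
  · rw [G.kemeny_eq, ENNReal.toReal_ofReal G.trace_deviation_nonneg, G.mulKirchhoff_eq]
  · rw [hN, ← G.pseudoinverse_normalizedLaplacian]
    exact_mod_cast hRstar
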